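/- Let $K$ be a field of arbitrary characteristic, let $R=K[x_1,\dots,x_n]$ with the standard grading ($\deg x_i=1$, $\deg c=0$ for $0\ne c\in K$), and let $\mathscr D=R\langle \partial_i^{[j]} : 1\le i\le n,\ j\ge 1\rangle\subseteq \operatorname{End}_K(R)$ be its ring of differential operators, where $\partial_i^{[j]}=\frac1{j!}\frac{\partial^j}{\partial x_i^j}$, with the $\mathbb Z$-grading $\deg x_i=1$, $\deg\partial_i^{[j]}=-j$, $\deg c=0$. For $r\ge 1$ let $$E_r=\sum_{i_1+\cdots+i_n=r,\ i_1,\dots,i_n\ge 0} x_1^{i_1}\cdots x_n^{i_n}\,\partial_1^{[i_1]}\cdots\partial_n^{[i_n]}\in\mathscr D .$$ A graded $\mathscr D$-module is a $\mathscr D$-module $M=\bigoplus_{k\in\mathbb Z}M_k$ with $\mathscr D_iM_j\subseteq M_{i+j}$. It is called Eulerian if $E_r\cdot z=\binom{\deg z}{r}z$ for every homogeneous $z\in M$ and every $r\ge 1$, where $\binom ar=\frac{a(a-1)\cdots(a-r+1)}{r!}$ for $a\in\mathbb Z$. If $J\subseteq R$ is a homogeneous ideal with homogeneous generators $f_1,\dots,f_l$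 and $M$ is a graded $\mathscr D$-module, the local cohomology module $H^i_J(M)$ is the $i$-th cohomology of the Čech complex $$0\to M\to\bigoplus_j M_{f_j}\to\bigoplus_{j<k}M_{f_jf_k}\to\cdots\to M_{f_1\cdots f_l}\to 0,$$ with the $\mathscr D$-module structure and the grading induced by those of the localizations of $M$ (where $\deg(z/f)=\deg z-\deg f$ for homogeneous $z$ and $f$). Theorem. Let $J_1,\dots,J_s$ be homogeneous ideals of $R$ and let $i_1,\dots,i_s\ge 0$. Then the iterated local cohomology module $$H^{i_1}_{J_1}\bigl(H^{i_2}_{J_2}(\cdots H^{i_s}_{J_s}(R)\cdots)\bigr)$$ is a graded $\mathscr D$-module, and it is Eulerian. -/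

import Mathlib

attribute [local instance] MvPolynomial.gradedAlgebra

noncomputable section

universe u

namespace Eulerian

/-! ### The ring of differential operators of a polynomial ring -/

/-- The divided power operator `∂_i^{[j]} = (1/j!) ∂^j/∂x_i^j` on `K[x_1, …, x_n]`: the `K`-linear
map sending a monomial `x^a` to `binom(a_i, j) x^(a - j e_i)` (which is `0` if `a_i < j`). -/
def hasse {K : Type u} [Field K] {n : ℕ} (i : Fin n) (j : ℕ) :
    Module.End K (MvPolynomial (Fin n) K) :=
  (MvPolynomial.basisMonomials (Fin n) K).constr K fun a =>
    MvPolynomial.monomial (a - Finsupp.single i j) (((a i).choose j : ℕ) : K)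

/-- The ring `𝒟 = R⟨∂_i^{[j]}⟩` of differential operators of `R = K[x_1, …, x_n]`: the subalgebra of
`End_K R` generated by the multiplications by elements of `R` and the `∂_i^{[j]}`
(`∂_i^{[0]}` is the identity). -/
def diffOps (K : Type u) [Field K] (n : ℕ) : Subalgebra K (Module.End K (MvPolynomial (Fin n) K)) :=
  Algebra.adjoin K
    (Set.range (Algebra.lmul K (MvPolynomial (Fin n) K)) ∪
      Set.range fun p : Fin n × ℕ => hasse p.1 p.2)

/-- The type of elements of `𝒟`. -/
def DiffOp (K : Type u) [Field K] (n : ℕ) : Type u := diffOps K n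

instance (K : Type u) [Field K] (n : ℕ) : Ring (DiffOp K n) := (diffOps K n).toRing

instance (K : Type u) [Field K] (n : ℕ) : Algebra K (DiffOp K n) := (diffOps K n).algebra

/-- The tautological inclusion of `𝒟` into `End_K R`. -/
def DiffOp.toEnd (K : Type u) [Field K] (n : ℕ) :
    DiffOp K n →ₐ[K] Module.End K (MvPolynomial (Fin n) K) :=
  (diffOps K n).val

/-- `𝒟` acts on `R` by evaluating operators. -/
instance (K : Type u) [Field K] (n : ℕ) : Module (DiffOp K n) (MvPolynomial (Fin n) K) :=
  Module.compHom (MvPolynomial (Fin n) K) (DiffOp.toEnd K n).toRingHom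

/-- The inclusion `R → 𝒟` of polynomials as multiplication operators. -/
def ofPoly (K : Type u) [Field K] (n : ℕ) : MvPolynomial (Fin n) K →ₐ[K] DiffOp K n :=
  (Algebra.lmul K (MvPolynomial (Fin n) K)).codRestrict (diffOps K n) fun g =>
    Algebra.subset_adjoin (Or.inl ⟨g, rfl⟩)

/-- `∂_i^{[j]}` as an element of `𝒟`. -/
def del (K : Type u) [Field K] {n : ℕ} (i : Fin n) (j : ℕ) : DiffOp K n :=
  ⟨hasse i j, Algebra.subset_adjoin (Or.inr ⟨(i, j), rfl⟩)⟩

/-- The operator `x_1^{a_1} ⋯ x_n^{a_n} ∂_1^{[b_1]} ⋯ ∂_n^{[b_n]}`. -/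
def monomialOp (K : Type u) [Field K] {n : ℕ} (a b : Fin n → ℕ) : DiffOp K n :=
  ofPoly K n (∏ i, MvPolynomial.X i ^ a i) * (List.ofFn fun i => del K i (b i)).prod

/-- The natural `ℤ`-grading of `𝒟`, with `deg x_i = 1`, `deg ∂_i^{[j]} = -j`, `deg c = 0` for
`c ∈ K`: the component of degree `k` is spanned over `K` by the
`x_1^{a_1} ⋯ x_n^{a_n} ∂_1^{[b_1]} ⋯ ∂_n^{[b_n]}` with `∑ a_i - ∑ b_i = k`. -/
def diffOpsGrading (K : Type u) [Field K] (n : ℕ) (k : ℤ) : Submodule K (DiffOp K n) :=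
  Submodule.span K {d | ∃ a b : Fin n → ℕ,
    (∑ i, (a i : ℤ)) - ∑ i, (b i : ℤ) = k ∧ d = monomialOp K a b}

/-- The `r`-th Euler operator
`E_r = ∑_{i_1 + ⋯ + i_n = r} x_1^{i_1} ⋯ x_n^{i_n} ∂_1^{[i_1]} ⋯ ∂_n^{[i_n]}`. -/
def eulerOp (K : Type u) [Field K] (n r : ℕ) : DiffOp K n :=
  ∑ a ∈ Finset.piAntidiag (Finset.univ : Finset (Fin n)) r, monomialOp K a a

/-! ### Graded `𝒟`-modules and Eulerian graded `𝒟`-modules -/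

/-- A (left) `𝒟`-module together with a family of additive subgroups, the candidates for its
homogeneous components. Whether this makes it a graded `𝒟`-module is the predicate
`DModule.IsGraded`. -/
structure DModule (K : Type u) [Field K] (n : ℕ) where
  carrier : Type u
  [addCommGroup : AddCommGroup carrier]
  [module : Module (DiffOp K n) carrier]
  /-- The component of degree `k`. -/
  gr : ℤ → AddSubgroup carrier

attribute [instance] DModule.addCommGroup DModule.module

/-- `M` is a graded `𝒟`-module: it is the direct sum of its components, and
`𝒟_i M_j ⊆ M_{i + j}`. -/
def DModule.IsGraded {K : Type u} [Field K] {n : ℕ} (M : DModule K n) : Prop :=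
  DirectSum.IsInternal M.gr ∧
    ∀ i j : ℤ, ∀ d ∈ diffOpsGrading K n i, ∀ z ∈ M.gr j, d • z ∈ M.gr (i + j)

/-- `M` is Eulerian: it is a graded `𝒟`-module, and `E_r z = binom(deg z, r) z` for every
homogeneous `z` and every `r ≥ 1`. Here `Ring.choose a r` is `a (a - 1) ⋯ (a - r + 1) / r!`,
an integer, for every integer `a`. -/
def DModule.IsEulerian {K : Type u} [Field K] {n : ℕ} (M : DModule K n) : Prop :=
  M.IsGraded ∧
    ∀ r : ℕ, 1 ≤ r → ∀ k : ℤ, ∀ z ∈ M.gr k, eulerOp K n r • z = Ring.choose k r • z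

/-- The `𝒟`-module `R` with the standard grading: the component of degree `k` consists of the
polynomials all of whose monomials have degree `k`. -/
def polyModule (K : Type u) [Field K] (n : ℕ) : DModule K n where
  carrier := MvPolynomial (Fin n) K
  gr k :=
    { carrier := {g | ∀ a : Fin n →₀ ℕ, g.coeff a ≠ 0 → (a.degree : ℤ) = k}
      zero_mem' := by intro a ha; simp at ha
      add_mem' := by
        intro g h hg hh a ha
        by_cases h0 : g.coeff a = 0
        · exact hh a (by simpa [h0] using ha)
        · exact hg a h0
      neg_mem' := by
        intro g hg a ha
        exact hg a (by simpa using ha) }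

/-! ### Localization of `𝒟`-modules

Multiplicative subsets of `R` satisfy the Ore condition in `𝒟`, so `S⁻¹M` is the Ore localization
of the `𝒟`-module `M`. -/

/-- `T` has order at most `m - 1`: all `m`-fold commutators with polynomials vanish. -/
def OrderLT {K : Type u} [Field K] {n : ℕ} : ℕ → DiffOp K n → Prop
  | 0, T => T = 0
  | m + 1, T => ∀ g : MvPolynomial (Fin n) K, OrderLT m (T * ofPoly K n g - ofPoly K n g * T)

theorem orderLT_zero {K : Type u} [Field K] {n : ℕ} (m : ℕ) :
    OrderLT m (0 : DiffOp K n) := by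
  induction m with
  | zero => rfl
  | succ m ih => intro g; simpa using ih

theorem OrderLT.succ {K : Type u} [Field K] {n : ℕ} {m : ℕ} {T : DiffOp K n}
    (h : OrderLT m T) : OrderLT (m + 1) T := by
  induction m generalizing T with
  | zero =>
    have h0 : T = 0 := h
    subst h0
    exact orderLT_zero 1
  | succ m ih => intro g; exact ih (h g)

theorem OrderLT.mono {K : Type u} [Field K] {n : ℕ} {m m' : ℕ} (hm : m ≤ m') {T : DiffOp K n}
    (h : OrderLT m T) : OrderLT m' T := by
  induction hm with
  | refl => exact h
  | step _ ih => exact ih.succ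

theorem OrderLT.add {K : Type u} [Field K] {n : ℕ} {m : ℕ} {T U : DiffOp K n}
    (hT : OrderLT m T) (hU : OrderLT m U) : OrderLT m (T + U) := by
  induction m generalizing T U with
  | zero =>
    have h0 : T = 0 := hT
    have h1 : U = 0 := hU
    subst h0 h1
    simp [OrderLT]
  | succ m ih =>
    intro g
    have := ih (hT g) (hU g)
    convert this using 1
    noncomm_ring

theorem orderLT_ofPoly {K : Type u} [Field K] {n : ℕ} (g : MvPolynomial (Fin n) K) :
    OrderLT 1 (ofPoly K n g) := by
  intro h
  change _ = _
  rw [← map_mul, ← map_mul, mul_comm, sub_self]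

theorem OrderLT.mul {K : Type u} [Field K] {n : ℕ} {m m' : ℕ} {T U : DiffOp K n}
    (hT : OrderLT m T) (hU : OrderLT m' U) : OrderLT (m + m') (T * U) := by
  induction hk : m + m' generalizing m m' T U with
  | zero =>
    obtain rfl : m = 0 := by omega
    have h0 : T = 0 := hT
    subst h0
    simp [OrderLT]
  | succ k ih =>
    intro g
    have key : T * U * ofPoly K n g - ofPoly K n g * (T * U) =
        T * (U * ofPoly K n g - ofPoly K n g * U) +
          (T * ofPoly K n g - ofPoly K n g * T) * U := by noncomm_ring
    rw [key]
    refine OrderLT.add ?_ ?_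
    · cases m' with
      | zero =>
        have h0 : U = 0 := hU
        subst h0
        simpa using orderLT_zero k
      | succ m' => exact ih hT (hU g) (by omega)
    · cases m with
      | zero =>
        have h0 : T = 0 := hT
        subst h0
        simpa using orderLT_zero k
      | succ m => exact ih (hT g) hU (by omega)

theorem orderLT_mul_ofPoly {K : Type u} [Field K] {n : ℕ} {m : ℕ} {T : DiffOp K n}
    (hT : OrderLT m T) (g : MvPolynomial (Fin n) K) :
    OrderLT m (T * ofPoly K n g) ∧ OrderLT m (ofPoly K n g * T) := by
  induction m generalizing T with
  | zero =>
    have h0 : T = 0 := hT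
    subst h0
    simp [OrderLT]
  | succ m ih =>
    have comm : ∀ h, ofPoly K n g * ofPoly K n h = ofPoly K n h * ofPoly K n g := fun h => by
      rw [← map_mul, ← map_mul, mul_comm]
    refine ⟨fun h => ?_, fun h => ?_⟩
    · have := (ih (hT h)).1
      rwa [sub_mul, mul_assoc, ← comm, ← mul_assoc, mul_assoc (ofPoly K n h)] at this
    · have := (ih (hT h)).2
      rwa [mul_sub, ← mul_assoc, ← mul_assoc, comm, mul_assoc (ofPoly K n h)] at this

theorem orderLT_succ_of_X {K : Type u} [Field K] {n : ℕ} {m : ℕ} {T : DiffOp K n}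
    (h : ∀ k : Fin n, OrderLT m
      (T * ofPoly K n (MvPolynomial.X k) - ofPoly K n (MvPolynomial.X k) * T)) :
    OrderLT (m + 1) T := by
  intro g
  induction g using MvPolynomial.induction_on with
  | C c =>
    have : ofPoly K n (MvPolynomial.C c) = algebraMap K (DiffOp K n) c :=
      (ofPoly K n).commutes c
    rw [this, Algebra.commutes, sub_self]
    exact orderLT_zero m
  | add p q hp hq =>
    have := hp.add hq
    convert this using 1
    rw [map_add]
    noncomm_ring
  | mul_X p k hp =>
    have := (orderLT_mul_ofPoly hp (MvPolynomial.X k)).1.add (orderLT_mul_ofPoly (h k) p).2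
    convert this using 1
    rw [map_mul]
    noncomm_ring

theorem hasse_monomial {K : Type u} [Field K] {n : ℕ} (i : Fin n) (j : ℕ) (a : Fin n →₀ ℕ) (c : K) :
    hasse i j (MvPolynomial.monomial a c) =
      MvPolynomial.monomial (a - Finsupp.single i j) (((a i).choose j : ℕ) * c) := by
  have : MvPolynomial.monomial a c = c • (MvPolynomial.basisMonomials (Fin n) K) a := by
    simp [MvPolynomial.smul_monomial]
  rw [this, map_smul, hasse, Module.Basis.constr_basis, MvPolynomial.smul_monomial, smul_eq_mul,
    mul_comm]

theorem hasse_X {K : Type u} [Field K] {n : ℕ} (i k : Fin n) (j : ℕ)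
    (g : MvPolynomial (Fin n) K) :
    hasse i (j + 1) (MvPolynomial.X k * g) =
      MvPolynomial.X k * hasse i (j + 1) g + if k = i then hasse i j g else 0 := by
  induction g using MvPolynomial.induction_on' with
  | add p q hp hq =>
    rw [mul_add, map_add, hp, hq, map_add, mul_add]
    split_ifs
    · rw [map_add]; ring
    · ring
  | monomial a c =>
    have hX : ∀ (b : Fin n →₀ ℕ) (c : K), MvPolynomial.X k * MvPolynomial.monomial b c =
        MvPolynomial.monomial (Finsupp.single k 1 + b) c := fun b c => by
      rw [MvPolynomial.X, MvPolynomial.monomial_mul, one_mul]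
    rw [hX, hasse_monomial, hasse_monomial, hX, hasse_monomial]
    split_ifs with hk
    · subst hk
      by_cases hj : a k < j + 1
      · have e : Finsupp.single k 1 + a - Finsupp.single k (j + 1) = a - Finsupp.single k j := by
          ext l
          by_cases hl : l = k
          · subst hl; simp; omega
          · simp [Ne.symm hl]
        rw [e, Nat.choose_eq_zero_of_lt hj]
        simp [Nat.add_comm 1 (a k), Nat.choose_succ_succ, Nat.choose_eq_zero_of_lt hj]
      · have e : Finsupp.single k 1 + a - Finsupp.single k (j + 1) = a - Finsupp.single k j := by
          ext l
          by_cases hl : l = k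
          · subst hl; simp; omega
          · simp [Ne.symm hl]
        have e' : Finsupp.single k 1 + (a - Finsupp.single k (j + 1)) =
            a - Finsupp.single k j := by
          ext l
          by_cases hl : l = k
          · subst hl; simp; omega
          · simp [Ne.symm hl]
        rw [e, e', ← map_add]
        congr 1
        simp only [Finsupp.add_apply, Finsupp.single_eq_same, Nat.add_comm 1 (a k),
          Nat.choose_succ_succ]
        push_cast
        ring
    · have e : Finsupp.single k 1 + a - Finsupp.single i (j + 1) =
          Finsupp.single k 1 + (a - Finsupp.single i (j + 1)) := by
        ext l
        by_cases hl : l = k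
        · subst hl; simp [Ne.symm hk]
        · simp [Ne.symm hl]
      rw [e]
      simp [hk]

theorem hasse_zero {K : Type u} [Field K] {n : ℕ} (i : Fin n) :
    (hasse i 0 : Module.End K (MvPolynomial (Fin n) K)) = 1 := by
  refine (MvPolynomial.basisMonomials (Fin n) K).ext fun a => ?_
  simp [hasse_monomial]

theorem orderLT_del {K : Type u} [Field K] {n : ℕ} (i : Fin n) (j : ℕ) :
    OrderLT (j + 1) (del K i j) := by
  have inj : Function.Injective (DiffOp.toEnd K n) := Subtype.val_injective
  induction j with
  | zero =>
    have : del K i 0 = ofPoly K n 1 := by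
      rw [map_one]
      exact inj (by rw [map_one]; exact hasse_zero i)
    rw [this]
    exact orderLT_ofPoly 1
  | succ j ih =>
    refine orderLT_succ_of_X fun k => ?_
    have : del K i (j + 1) * ofPoly K n (MvPolynomial.X k) -
        ofPoly K n (MvPolynomial.X k) * del K i (j + 1) = if k = i then del K i j else 0 := by
      apply inj
      rw [map_sub, map_mul, map_mul]
      refine LinearMap.ext fun g => ?_
      have := hasse_X i k j g
      change hasse i (j + 1) (MvPolynomial.X k * g) -
        MvPolynomial.X k * hasse i (j + 1) g = _
      rw [this, add_sub_cancel_left]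
      split_ifs <;> rfl
    rw [this]
    split_ifs
    · exact ih
    · exact orderLT_zero _

theorem exists_orderLT {K : Type u} [Field K] {n : ℕ} (T : DiffOp K n) : ∃ m, OrderLT m T := by
  obtain ⟨T, hT⟩ := T
  refine Algebra.adjoin_induction (p := fun T hT => ∃ m, OrderLT m (⟨T, hT⟩ : DiffOp K n))
    ?_ ?_ ?_ ?_ hT
  · rintro _ (⟨g, rfl⟩ | ⟨p, rfl⟩)
    · exact ⟨1, orderLT_ofPoly g⟩
    · exact ⟨p.2 + 1, orderLT_del p.1 p.2⟩
  · intro c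
    have : ofPoly K n (MvPolynomial.C c) = algebraMap K (DiffOp K n) c :=
      (ofPoly K n).commutes c
    have h1 := orderLT_ofPoly (MvPolynomial.C c : MvPolynomial (Fin n) K)
    rw [this] at h1
    exact ⟨1, h1⟩
  · rintro x y hx hy ⟨m, hm⟩ ⟨m', hm'⟩
    exact ⟨max m m', (hm.mono (le_max_left _ _)).add (hm'.mono (le_max_right _ _))⟩
  · rintro x y hx hy ⟨m, hm⟩ ⟨m', hm'⟩
    exact ⟨m + m', hm.mul hm'⟩

theorem OrderLT.pow_mul_eq_zero {K : Type u} [Field K] {n : ℕ} {m : ℕ} {T : DiffOp K n}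
    (hT : OrderLT m T) (s : MvPolynomial (Fin n) K) (h : T * ofPoly K n s = 0) :
    ofPoly K n s ^ m * T = 0 := by
  induction m generalizing T with
  | zero =>
    have h0 : T = 0 := hT
    simp [h0]
  | succ m ih =>
    have h1 := hT s
    rw [h, zero_sub] at h1
    have h2 := ih h1 (by rw [neg_mul, mul_assoc, h, mul_zero, neg_zero])
    rwa [mul_neg, neg_eq_zero, ← mul_assoc, ← pow_succ] at h2

theorem OrderLT.exists_pow_mul {K : Type u} [Field K] {n : ℕ} {m : ℕ} {T : DiffOp K n}
    (hT : OrderLT m T) (s : MvPolynomial (Fin n) K) :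
    ∃ U : DiffOp K n, ofPoly K n s ^ m * T = U * ofPoly K n s := by
  induction m generalizing T with
  | zero =>
    have h0 : T = 0 := hT
    exact ⟨0, by simp [h0]⟩
  | succ m ih =>
    obtain ⟨U, hU⟩ := ih (hT s)
    refine ⟨ofPoly K n s ^ m * T - U, ?_⟩
    rw [sub_mul, ← hU, pow_succ]
    noncomm_ring

/-- The image in `𝒟` of a multiplicative subset `S` of `R`. -/
abbrev mulSet {K : Type u} [Field K] {n : ℕ} (S : Submonoid (MvPolynomial (Fin n) K)) :
    Submonoid (DiffOp K n) :=
  S.map (ofPoly K n)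

theorem mulSet_mono {K : Type u} [Field K] {n : ℕ} {S T : Submonoid (MvPolynomial (Fin n) K)}
    (h : S ≤ T) : mulSet S ≤ mulSet T := by
  rintro _ ⟨s, hs, rfl⟩
  exact ⟨s, h hs, rfl⟩

theorem nonempty_oreSet {K : Type u} [Field K] {n : ℕ}
    (S : Submonoid (MvPolynomial (Fin n) K)) : Nonempty (OreLocalization.OreSet (mulSet S)) := by
  rw [OreLocalization.nonempty_oreSet_iff]
  constructor
  · rintro r₁ r₂ ⟨_, s, hs, rfl⟩ h
    obtain ⟨m, hm⟩ := exists_orderLT (r₁ - r₂)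
    refine ⟨⟨ofPoly K n (s ^ m), ⟨s ^ m, pow_mem hs m, rfl⟩⟩, ?_⟩
    have := hm.pow_mul_eq_zero s (by rw [sub_mul]; exact sub_eq_zero.mpr h)
    rw [mul_sub, sub_eq_zero, ← map_pow] at this
    exact this
  · rintro r ⟨_, s, hs, rfl⟩
    obtain ⟨m, hm⟩ := exists_orderLT r
    obtain ⟨U, hU⟩ := hm.exists_pow_mul s
    refine ⟨U, ⟨ofPoly K n (s ^ m), ⟨s ^ m, pow_mem hs m, rfl⟩⟩, ?_⟩
    rw [← map_pow] at hU
    exact hU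

instance {K : Type u} [Field K] {n : ℕ} (S : Submonoid (MvPolynomial (Fin n) K)) :
    OreLocalization.OreSet (mulSet S) :=
  Classical.choice (nonempty_oreSet S)

/-- The natural localization map `S⁻¹X → T⁻¹X`, `z / s ↦ z / s`, for `S ⊆ T`. -/
def locMap {K : Type u} [Field K] {n : ℕ} (X : Type u) [AddCommGroup X] [Module (DiffOp K n) X]
    {S T : Submonoid (MvPolynomial (Fin n) K)} (h : S ≤ T) :
    OreLocalization (mulSet S) X →ₗ[DiffOp K n] OreLocalization (mulSet T) X where
  toFun := OreLocalization.liftExpand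
    (fun z s => OreLocalization.oreDiv z ⟨s.1, mulSet_mono h s.2⟩)
    (fun z t s ht => OreLocalization.expand z ⟨s.1, mulSet_mono h s.2⟩ t (mulSet_mono h ht))
  map_add' := by
    intro x y
    induction x using OreLocalization.ind with | _ x s =>
    induction y using OreLocalization.ind with | _ y t =>
    obtain ⟨r, u, hru⟩ := OreLocalization.oreCondition (s : DiffOp K n) t
    rw [OreLocalization.oreDiv_add_char s t r u hru, OreLocalization.liftExpand_of,
      OreLocalization.liftExpand_of, OreLocalization.liftExpand_of,
      OreLocalization.oreDiv_add_char ⟨s.1, mulSet_mono h s.2⟩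
        ⟨t.1, mulSet_mono h t.2⟩ r ⟨u.1, mulSet_mono h u.2⟩ hru]
    rfl
  map_smul' := by
    intro d x
    induction x using OreLocalization.ind with | _ x s =>
    obtain ⟨r, u, hru⟩ := OreLocalization.oreCondition d s
    rw [RingHom.id_apply, OreLocalization.liftExpand_of, ← OreLocalization.oreDiv_one_smul,
      ← OreLocalization.oreDiv_one_smul, OreLocalization.oreDiv_smul_char d x 1 s r u hru,
      OreLocalization.oreDiv_smul_char d x 1 ⟨s.1, mulSet_mono h s.2⟩ r
        ⟨u.1, mulSet_mono h u.2⟩ hru, OreLocalization.liftExpand_of]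
    congr 1

/-- The grading of `S⁻¹M` given by `deg (z / s) = deg z - deg s` for homogeneous `z ∈ M`, `s ∈ S`:
the component of degree `k` is the additive subgroup generated by these fractions of degree `k`. -/
def locGr {K : Type u} [Field K] {n : ℕ} (M : DModule K n)
    (S : Submonoid (MvPolynomial (Fin n) K)) (k : ℤ) :
    AddSubgroup (OreLocalization (mulSet S) M.carrier) :=
  AddSubgroup.closure {w | ∃ (s : MvPolynomial (Fin n) K) (hs : s ∈ S) (e : ℕ)
    (z : M.carrier), s.IsHomogeneous e ∧ z ∈ M.gr (k + e) ∧
      w = OreLocalization.oreDiv z ⟨ofPoly K n s, Submonoid.mem_map_of_mem _ hs⟩}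

/-! ### The Čech complex and local cohomology

For a finite family `f` of polynomials and a set `A` of indices, the localization of `M` at the
product of the `f_j`, `j ∈ A`, is obtained by inverting the multiplicative set generated by these
`f_j`. -/

/-- The multiplicative subset of `R` generated by the `f_j` with `j ∈ A`. -/
def mulGen {K : Type u} [Field K] {n l : ℕ} (f : Fin l → MvPolynomial (Fin n) K)
    (A : Finset (Fin l)) : Submonoid (MvPolynomial (Fin n) K) :=
  Submonoid.closure (f '' (A : Set (Fin l)))

theorem mulGen_mono {K : Type u} [Field K] {n l : ℕ} (f : Fin l → MvPolynomial (Fin n) K)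
    {A B : Finset (Fin l)} (h : A ⊆ B) : mulGen f A ≤ mulGen f B :=
  Submonoid.closure_mono (Set.image_mono (by exact_mod_cast h))

/-- The `p`-th term `⨁_{|A| = p} M_{f_A}` of the Čech complex of `M` with respect to `f`. -/
abbrev CechTerm {K : Type u} [Field K] {n l : ℕ} (f : Fin l → MvPolynomial (Fin n) K)
    (M : DModule K n) (p : ℕ) : Type u :=
  ∀ A : {A : Finset (Fin l) // A.card = p}, OreLocalization (mulSet (mulGen f A.1)) M.carrier

/-- The Čech differential: `(dφ)_B = ∑_{j ∈ B} (-1)^{#{k ∈ B | k < j}} φ_{B \ {j}}`, each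
`φ_{B \ {j}}` being mapped to `M_{f_B}` by the natural localization map. -/
def cechD {K : Type u} [Field K] {n l : ℕ} (f : Fin l → MvPolynomial (Fin n) K)
    (M : DModule K n) (p : ℕ) : CechTerm f M p →ₗ[DiffOp K n] CechTerm f M (p + 1) where
  toFun φ B := ∑ j : {j : Fin l // j ∈ B.1},
    ((-1 : DiffOp K n) ^ (B.1.filter fun k => k < j.1).card) •
      locMap M.carrier (mulGen_mono f (Finset.erase_subset j.1 B.1))
        (φ ⟨B.1.erase j.1, by rw [Finset.card_erase_of_mem j.2, B.2, Nat.add_sub_cancel]⟩)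
  map_add' φ ψ := by
    funext B
    simp only [Pi.add_apply, map_add, smul_add, Finset.sum_add_distrib]
  map_smul' d φ := by
    funext B
    simp only [Pi.smul_apply, map_smul, RingHom.id_apply, Finset.smul_sum, smul_smul,
      ((Commute.neg_one_left d).pow_left _).eq]

/-- The coboundaries of degree `p`: the image of the differential into the `p`-th term. -/
def cechCoboundary {K : Type u} [Field K] {n l : ℕ} (f : Fin l → MvPolynomial (Fin n) K)
    (M : DModule K n) : (p : ℕ) → Submodule (DiffOp K n) (CechTerm f M p)
  | 0 => ⊥
  | p + 1 => LinearMap.range (cechD f M p)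

/-- The `p`-th cohomology `𝒟`-module (cocycles modulo coboundaries) of the Čech complex of `M` with
respect to `f`. A class has degree `k` if it is represented by a cocycle all of whose entries have
degree `k`. -/
def cechCohomology {K : Type u} [Field K] {n l : ℕ} (f : Fin l → MvPolynomial (Fin n) K)
    (p : ℕ) (M : DModule K n) : DModule K n where
  carrier := LinearMap.ker (cechD f M p) ⧸
    (cechCoboundary f M p).submoduleOf (LinearMap.ker (cechD f M p))
  gr k :=
    ((AddSubgroup.pi Set.univ fun A : {A : Finset (Fin l) // A.card = p} =>
        locGr M (mulGen f A.1) k).comap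
      (LinearMap.ker (cechD f M p)).subtype.toAddMonoidHom).map
      ((cechCoboundary f M p).submoduleOf (LinearMap.ker (cechD f M p))).mkQ.toAddMonoidHom

/-- A finite family of homogeneous polynomials generating the ideal `J`. -/
structure HomogeneousGenerators {K : Type u} [Field K] {n : ℕ}
    (J : Ideal (MvPolynomial (Fin n) K)) where
  size : ℕ
  gen : Fin size → MvPolynomial (Fin n) K
  isHomogeneous : ∀ j, ∃ e : ℕ, (gen j).IsHomogeneous e
  span_eq : Ideal.span (Set.range gen) = J

/-- Every homogeneous ideal of `R` has finitely many homogeneous generators. -/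
theorem HomogeneousGenerators.nonempty {K : Type u} [Field K] {n : ℕ}
    {J : Ideal (MvPolynomial (Fin n) K)}
    (hJ : J.IsHomogeneous (MvPolynomial.homogeneousSubmodule (Fin n) K)) :
    Nonempty (HomogeneousGenerators J) := by
  have hspan := hJ.toIdeal_homogeneousCore_eq_self.symm
  have hfg : J.FG := IsNoetherian.noetherian J
  rw [hspan] at hfg
  obtain ⟨t, ht, htJ⟩ := Submodule.fg_span_iff_fg_span_finset_subset _ |>.mp hfg
  refine ⟨⟨t.card, fun j => (t.equivFin.symm j).1, fun j => ?_, ?_⟩⟩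
  · obtain ⟨⟨x, e, he⟩, _, hx⟩ := ht (t.equivFin.symm j).2
    exact ⟨e, by rw [← hx]; exact he⟩
  · have hr : Set.range (fun j => ((t.equivFin.symm j).1 : MvPolynomial (Fin n) K)) = t := by
      ext x
      constructor
      · rintro ⟨j, rfl⟩
        exact (t.equivFin.symm j).2
      · intro hx
        exact ⟨t.equivFin ⟨x, hx⟩, by simp⟩
    rw [hr]
    exact htJ.symm.trans hspan.symm

/-- The local cohomology module `H^i_J(M)`, as the cohomology of the Čech complex of `M` with
respect to the homogeneous generators `g` of `J`. -/
def localCohomology {K : Type u} [Field K] {n : ℕ} {J : Ideal (MvPolynomial (Fin n) K)}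
    (g : HomogeneousGenerators J) (i : ℕ) (M : DModule K n) : DModule K n :=
  cechCohomology g.gen i M

/-- The iterated local cohomology module `H^{i_1}_{J_1}(H^{i_2}_{J_2}(⋯ H^{i_s}_{J_s}(R)))`. -/
def iteratedLocalCohomology {K : Type u} [Field K] {n : ℕ} : {s : ℕ} →
    {J : Fin s → Ideal (MvPolynomial (Fin n) K)} → ((k : Fin s) → HomogeneousGenerators (J k)) →
    (Fin s → ℕ) → DModule K n
  | 0, _, _, _ => polyModule K n
  | _ + 1, _, g, i =>
    localCohomology (g 0) (i 0) (iteratedLocalCohomology (fun k => g k.succ) fun k => i k.succ)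

end Eulerian

end

universe u

namespace Eulerian

open Finset

/-! Everything rests on Vandermonde's identity. Each summand of `E_r` scales a monomial `x^c` by a
product of binomials in the `c_i`, and these add up to `binom(|c|, r)`; hence `R` is Eulerian. It
remains to see that Čech cohomology preserves the property.

Localization: let `w = z / s` have degree `k`, with `deg s = e`. Then `s w = z / 1`, so operators
act on `s w` in a known way. Commuting `E_r` past `s` (`eulerOp_mul_ofPoly`) and cancelling `s`
determines `E_r w` by induction on `r`, again through Vandermonde. The same induction, with the
Leibniz rule `del_mul_ofPoly`, shows that `∂_i^{[j]}` shifts degrees correctly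
(`EulerianGrading.locGr`).

Kernels and quotients: the values `binom(k, r)`, for all `r`, separate integers in every field, even
in characteristic `p`, where `E_1` alone sees only `k` modulo `p` (`exists_choose_ne`).
Interpolating in the Euler operators therefore yields elements of `𝒟` that project onto a component.
So every `𝒟`-submodule is homogeneous (`mem_of_sum_mem`), and a spanning family with the Eulerian
property is automatically a direct sum (`isInternal`). Cocycles and coboundaries are `𝒟`-submodules,
so the cohomology inherits its grading without any degree check on the Čech differential. -/

theorem sum_piAntidiag_prod_choose {ι : Type*} [DecidableEq ι] (s : Finset ι) (c : ι → ℕ) (r : ℕ) :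
    ∑ a ∈ piAntidiag s r, ∏ i ∈ s, (c i).choose (a i) = (∑ i ∈ s, c i).choose r := by
  induction s using Finset.cons_induction generalizing r with
  | empty => cases r <;> simp
  | cons i s hi ih =>
    rw [piAntidiag_cons hi, sum_disjiUnion, sum_cons, Nat.add_choose_eq]
    refine sum_congr rfl fun p _ => ?_
    rw [sum_map, ← ih, mul_sum]
    refine sum_congr rfl fun a ha => ?_
    -- Members of `piAntidiag s` vanish off `s`, so after the shift the value at `i` is exactly
    -- `p.1`.
    have hai : a i = 0 := by
      by_contra h
      exact hi ((mem_piAntidiag.mp ha).2 i h)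
    rw [prod_cons]
    congr 1
    · simp [hai]
    · refine prod_congr rfl fun j hj => ?_
      have : j ≠ i := fun h => hi (h ▸ hj)
      simp [this]

/-! ### Evaluating operators on monomials -/

section Operators

variable {K : Type*} [Field K] {n : ℕ}

theorem toEnd_injective : Function.Injective (DiffOp.toEnd K n) := Subtype.val_injective

theorem smul_poly (T : DiffOp K n) (g : MvPolynomial (Fin n) K) : T • g = DiffOp.toEnd K n T g := rfl

theorem ofPoly_smul_poly (f g : MvPolynomial (Fin n) K) : ofPoly K n f • g = f * g := rfl

theorem del_smul_poly (i : Fin n) (j : ℕ) (g : MvPolynomial (Fin n) K) :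
    del K i j • g = hasse i j g := rfl

/-- `𝒟` acts faithfully on `R`, being a subalgebra of `End_K R`. This turns operator identities into
identities between binomial coefficients. -/
theorem diffOp_ext {T U : DiffOp K n}
    (h : ∀ a c, T • (MvPolynomial.monomial a c : MvPolynomial (Fin n) K) =
      U • MvPolynomial.monomial a c) : T = U := by
  apply toEnd_injective
  refine (MvPolynomial.basisMonomials (Fin n) K).ext fun a => ?_
  simpa [smul_poly] using h a 1

theorem algebraMap_eq_ofPoly (c : K) :
    algebraMap K (DiffOp K n) c = ofPoly K n (MvPolynomial.C c) :=
  ((ofPoly K n).commutes c).symm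

theorem algebraMap_smul_poly (c : K) (g : MvPolynomial (Fin n) K) :
    algebraMap K (DiffOp K n) c • g = c • g := by
  rw [algebraMap_eq_ofPoly, ofPoly_smul_poly, MvPolynomial.C_mul']

theorem list_prod_del_smul_monomial (b : Fin n → ℕ) (l : List (Fin n)) (hl : l.Nodup)
    (c : Fin n →₀ ℕ) (k : K) :
    (l.map fun i => del K i (b i)).prod • MvPolynomial.monomial c k =
      MvPolynomial.monomial (c - (l.map fun i => Finsupp.single i (b i)).sum)
        (((l.map fun i => (c i).choose (b i)).prod : ℕ) * k) := by
  induction l with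
  | nil => simp
  | cons i l ih =>
    obtain ⟨hi, hl⟩ := List.nodup_cons.mp hl
    -- The list has no repetition, so the operators applied earlier leave the exponent of `x_i`
    -- equal to `c i`.
    have h0 : ∀ l : List (Fin n), i ∉ l →
        (l.map fun i => Finsupp.single i (b i)).sum i = 0 := by
      intro l
      induction l with
      | nil => simp
      | cons j l ih =>
        intro h
        rw [List.mem_cons, not_or] at h
        simp [ih h.2, Ne.symm h.1]
    rw [List.map_cons, List.prod_cons, ← smul_smul, ih hl, del_smul_poly, hasse_monomial]
    simp only [List.map_cons, List.sum_cons, List.prod_cons, Finsupp.tsub_apply, h0 l hi,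
      Nat.sub_zero]
    rw [tsub_tsub, add_comm, Nat.cast_mul, mul_assoc]

theorem prod_X_pow (a : Fin n → ℕ) :
    (∏ i, MvPolynomial.X i ^ a i : MvPolynomial (Fin n) K) =
      MvPolynomial.monomial (Finsupp.equivFunOnFinite.symm a) 1 := by
  rw [MvPolynomial.monomial_eq, MvPolynomial.C_1, one_mul, Finsupp.prod_fintype _ _ (by simp)]
  rfl

theorem list_sum_single (b : Fin n → ℕ) :
    ((List.finRange n).map fun i => Finsupp.single i (b i)).sum =
      Finsupp.equivFunOnFinite.symm b := by
  rw [← List.ofFn_eq_map, List.sum_ofFn]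
  exact Finsupp.univ_sum_single (Finsupp.equivFunOnFinite.symm b)

theorem monomialOp_smul_monomial (a b : Fin n → ℕ) (c : Fin n →₀ ℕ) (k : K) :
    monomialOp K a b • MvPolynomial.monomial c k =
      MvPolynomial.monomial (Finsupp.equivFunOnFinite.symm a +
        (c - Finsupp.equivFunOnFinite.symm b)) ((∏ i, (c i).choose (b i) : ℕ) * k) := by
  rw [monomialOp, ← smul_smul, List.ofFn_eq_map,
    list_prod_del_smul_monomial b _ (List.nodup_finRange n), list_sum_single, prod_X_pow,
    ofPoly_smul_poly, MvPolynomial.monomial_mul, one_mul, ← List.ofFn_eq_map, List.prod_ofFn]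

/-- Every summand of `E_r` is diagonal on monomials; Vandermonde adds up the eigenvalues. -/
theorem eulerOp_smul_monomial (r : ℕ) (c : Fin n →₀ ℕ) (k : K) :
    eulerOp K n r • MvPolynomial.monomial c k =
      (c.degree.choose r : ℕ) • MvPolynomial.monomial c k := by
  have key : ∀ a : Fin n → ℕ, monomialOp K a a • MvPolynomial.monomial c k =
      (∏ i, (c i).choose (a i)) • MvPolynomial.monomial c k := by
    intro a
    rw [monomialOp_smul_monomial, ← map_nsmul, nsmul_eq_mul]
    -- The exponent `a + (c - a)` uses truncated subtraction. Where it differs from `c`, some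
    -- binomial factor is zero.
    by_cases h : Finsupp.equivFunOnFinite.symm a ≤ c
    · rw [add_tsub_cancel_of_le h]
    · obtain ⟨i, hi⟩ : ∃ i, c i < a i := by
        by_contra! h'
        exact h fun i => h' i
      rw [prod_eq_zero (mem_univ i) (Nat.choose_eq_zero_of_lt hi)]
      simp
  rw [eulerOp, sum_smul, sum_congr rfl fun a _ => key a, ← sum_smul, sum_piAntidiag_prod_choose,
    Finsupp.degree_eq_sum]

/-- The convolution sums below contain `E_0`, to which the Eulerian condition, stated for `r ≥ 1`,
does not apply. -/
theorem eulerOp_zero : eulerOp K n 0 = 1 :=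
  diffOp_ext fun a c => by simp [eulerOp_smul_monomial]

/-- The Leibniz rule for divided powers: on monomials it is Vandermonde in the `i`-th exponent. -/
theorem del_mul_ofPoly (i : Fin n) (j : ℕ) (f : MvPolynomial (Fin n) K) :
    del K i j * ofPoly K n f =
      ∑ p ∈ antidiagonal j, ofPoly K n (hasse i p.1 f) * del K i p.2 := by
  induction f using MvPolynomial.induction_on' with
  | add f g hf hg =>
    simp only [map_add, mul_add, add_mul, sum_add_distrib, hf, hg]
  | monomial a c =>
    refine diffOp_ext fun b d => ?_
    rw [← smul_smul, ofPoly_smul_poly, MvPolynomial.monomial_mul, del_smul_poly, hasse_monomial,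
      sum_smul, Finsupp.add_apply, Nat.add_choose_eq, Nat.cast_sum, sum_mul, map_sum]
    refine sum_congr rfl fun p hp => ?_
    rw [HasAntidiagonal.mem_antidiagonal] at hp
    rw [← smul_smul, ofPoly_smul_poly, del_smul_poly, hasse_monomial, hasse_monomial,
      MvPolynomial.monomial_mul]
    -- If either subtraction truncates, both sides have coefficient zero; otherwise the exponents
    -- agree.
    by_cases h1 : a i < p.1
    · simp [Nat.choose_eq_zero_of_lt h1]
    by_cases h2 : b i < p.2
    · simp [Nat.choose_eq_zero_of_lt h2]
    have hexp : a + b - Finsupp.single i j =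
        a - Finsupp.single i p.1 + (b - Finsupp.single i p.2) := by
      ext l
      by_cases hl : l = i
      · subst hl
        simp
        omega
      · simp [hl]
    rw [hexp]
    congr 1
    push_cast
    ring

/-- Multiplication by a homogeneous polynomial of degree `e` intertwines the Euler operators. -/
theorem eulerOp_mul_ofPoly (r e : ℕ) {f : MvPolynomial (Fin n) K} (hf : f.IsHomogeneous e) :
    eulerOp K n r * ofPoly K n f =
      ofPoly K n f * ∑ p ∈ antidiagonal r, e.choose p.1 • eulerOp K n p.2 := by
  refine diffOp_ext fun b d => ?_
  simp only [← smul_smul, sum_smul, smul_assoc, eulerOp_smul_monomial, ofPoly_smul_poly]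
  -- By linearity `f` may be replaced by its monomials, all of degree `e`; what remains is
  -- Vandermonde for `binom(e + |b|, r)`.
  rw [f.as_sum, sum_mul, smul_sum, sum_mul]
  refine sum_congr rfl fun a ha => ?_
  have hae : a.degree = e := by
    rw [Finsupp.degree_eq_weight_one]
    exact hf (MvPolynomial.mem_support_iff.mp ha)
  rw [MvPolynomial.monomial_mul, eulerOp_smul_monomial, map_add, Nat.add_choose_eq, hae, sum_smul,
    mul_sum]
  refine sum_congr rfl fun p _ => ?_
  rw [mul_smul_comm, mul_smul_comm, MvPolynomial.monomial_mul, ← smul_smul]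

end Operators

/-! ### Homogeneous polynomials and the grading of `𝒟` -/

section Poly

variable (K : Type*) [Field K] (n : ℕ)

theorem mem_polyModule_gr {k : ℤ} {g : MvPolynomial (Fin n) K} :
    g ∈ (polyModule K n).gr k ↔ ∀ a : Fin n →₀ ℕ, g.coeff a ≠ 0 → (a.degree : ℤ) = k :=
  Iff.rfl

variable {K n}

theorem monomial_mem_polyModule_gr {k : ℤ} {a : Fin n →₀ ℕ} {c : K} (h : c ≠ 0 → (a.degree : ℤ) = k) :
    MvPolynomial.monomial a c ∈ (polyModule K n).gr k := by
  rw [mem_polyModule_gr]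
  intro b hb
  rw [MvPolynomial.coeff_monomial] at hb
  split_ifs at hb with hab
  · exact hab ▸ h hb
  · exact absurd rfl hb

theorem polyModule_gr_induction {k : ℤ} {p : MvPolynomial (Fin n) K → Prop}
    (monomial : ∀ a c, (a.degree : ℤ) = k → p (MvPolynomial.monomial a c))
    (zero : p 0) (add : ∀ f g, p f → p g → p (f + g))
    {g : MvPolynomial (Fin n) K} (hg : g ∈ (polyModule K n).gr k) : p g := by
  rw [g.as_sum]
  refine sum_induction _ p (fun f g => add f g) zero fun a ha => monomial _ _ ?_
  exact hg a (MvPolynomial.mem_support_iff.mp ha)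

theorem IsHomogeneous.mem_polyModule_gr {e : ℕ} {f : MvPolynomial (Fin n) K}
    (hf : f.IsHomogeneous e) : f ∈ (polyModule K n).gr e := by
  intro a ha
  rw [Finsupp.degree_eq_weight_one]
  exact_mod_cast hf ha

theorem ofPoly_mem_diffOpsGrading {k : ℤ} {g : MvPolynomial (Fin n) K}
    (hg : g ∈ (polyModule K n).gr k) : ofPoly K n g ∈ diffOpsGrading K n k := by
  refine polyModule_gr_induction (p := fun g => ofPoly K n g ∈ diffOpsGrading K n k) ?_ ?_ ?_ hg
  · intro a c ha
    have : ofPoly K n (MvPolynomial.monomial a c) = c • monomialOp K a 0 := by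
      refine diffOp_ext fun b d => ?_
      rw [Algebra.smul_def, ← smul_smul, algebraMap_smul_poly, monomialOp_smul_monomial,
        ofPoly_smul_poly, MvPolynomial.monomial_mul, ← map_smul]
      congr 2
      · ext; simp
      · simp
    rw [this]
    refine Submodule.smul_mem _ _ (Submodule.subset_span ⟨a, 0, ?_, rfl⟩)
    rw [← ha, Finsupp.degree_eq_sum]
    simp
  · rw [map_zero]; exact zero_mem _
  · intro f g hf hg
    rw [map_add]; exact add_mem hf hg

theorem del_mem_diffOpsGrading (i : Fin n) (j : ℕ) : del K i j ∈ diffOpsGrading K n (-j) := by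
  refine Submodule.subset_span ⟨0, Pi.single i j, ?_, ?_⟩
  · simp [← Nat.cast_sum]
  · refine diffOp_ext fun a c => ?_
    rw [monomialOp_smul_monomial, del_smul_poly, hasse_monomial]
    congr 2
    · ext l
      by_cases hl : l = i
      · subst hl; simp
      · simp [hl]
    · rw [prod_eq_single i]
      · simp
      · intro b _ hb; simp [hb]
      · simp

end Poly

/-- A family of subgroups on which polynomials and divided powers act with the right degrees is
compatible with the whole grading of `𝒟`. -/
theorem smul_mem_of_generators {K : Type*} [Field K] {n : ℕ} {X : Type*} [AddCommGroup X]
    [Module (DiffOp K n) X] {gr : ℤ → AddSubgroup X}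
    (hpoly : ∀ (e k : ℤ), ∀ f ∈ (polyModule K n).gr e, ∀ z ∈ gr k,
      ofPoly K n f • z ∈ gr (e + k))
    (hdel : ∀ (i : Fin n) (j : ℕ) (k : ℤ), ∀ z ∈ gr k, del K i j • z ∈ gr (-j + k))
    (i k : ℤ) (d : DiffOp K n) (hd : d ∈ diffOpsGrading K n i) (z : X) (hz : z ∈ gr k) :
    d • z ∈ gr (i + k) := by
  have hlist : ∀ (b : Fin n → ℕ) (l : List (Fin n)),
      (l.map fun i => del K i (b i)).prod • z ∈ gr (-((l.map b).sum : ℕ) + k) := by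
    intro b l
    induction l with
    | nil => simpa using hz
    | cons i l ih =>
      have := hdel i (b i) _ _ ih
      rw [List.map_cons, List.map_cons, List.prod_cons, ← smul_smul, List.sum_cons]
      convert this using 2
      push_cast
      ring
  induction hd using Submodule.span_induction with
  | mem d hd =>
    obtain ⟨a, b, hab, rfl⟩ := hd
    have h1 := hlist b (List.finRange n)
    rw [← List.ofFn_eq_map, ← List.ofFn_eq_map, List.sum_ofFn] at h1
    have h2 : (∏ i, MvPolynomial.X i ^ a i : MvPolynomial (Fin n) K) ∈
        (polyModule K n).gr (∑ i, (a i : ℤ)) := by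
      rw [prod_X_pow]
      refine monomial_mem_polyModule_gr fun _ => ?_
      rw [Finsupp.degree_eq_sum]
      simp
    have := hpoly _ _ _ h2 _ h1
    rw [monomialOp, ← smul_smul]
    convert this using 2
    rw [← hab]
    push_cast
    ring
  | zero => rw [zero_smul]; exact zero_mem _
  | add x y _ _ hx hy => rw [add_smul]; exact add_mem hx hy
  | smul c x _ hx =>
    -- The components are only additive subgroups, so a scalar is treated as a polynomial of degree
    -- `0`.
    rw [Algebra.smul_def, ← smul_smul, algebraMap_eq_ofPoly]
    have hc : (MvPolynomial.C c : MvPolynomial (Fin n) K) ∈ (polyModule K n).gr 0 :=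
      monomial_mem_polyModule_gr fun _ => by simp
    simpa using hpoly _ _ _ hc _ hx

/-! ### Eulerian gradings: projections, submodules, quotients -/

section Grading

theorem choose_add (a b : ℤ) (r : ℕ) : Ring.choose (a + b) r =
    ∑ p ∈ antidiagonal r, Ring.choose a p.1 * Ring.choose b p.2 :=
  Ring.add_choose_eq r (Commute.all a b)

/-- Distinct integers are distinguished by the values of some binomial coefficient in `K`. -/
theorem exists_choose_ne (K : Type*) [Field K] {k l : ℤ} (h : k ≠ l) :
    ∃ r : ℕ, 1 ≤ r ∧ ((Ring.choose k r : ℤ) : K) ≠ ((Ring.choose l r : ℤ) : K) := by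
  wlog hkl : l < k generalizing k l
  · obtain ⟨r, hr, h'⟩ := this h.symm (lt_of_le_of_ne (not_lt.mp hkl) h)
    exact ⟨r, hr, h'.symm⟩
  by_contra! H
  have H' : ∀ r : ℕ, ((Ring.choose k r : ℤ) : K) = ((Ring.choose l r : ℤ) : K) := by
    intro r
    rcases Nat.eq_zero_or_pos r with rfl | hr
    · simp
    · exact H r hr
  obtain ⟨d, hd⟩ := Int.eq_ofNat_of_zero_le (sub_nonneg.mpr hkl.le)
  have hd0 : d ≠ 0 := by omega
  -- Vandermonde transports the assumed equalities from `k, l` to `k - l, 0`. For `d = k - l > 0`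
  -- this reads `binom(d, d) = binom(0, d)`, that is, `1 = 0` in `K`.
  have h1 : ((Ring.choose (k + -l) d : ℤ) : K) = ((Ring.choose (l + -l) d : ℤ) : K) := by
    rw [choose_add, choose_add]
    push_cast
    exact sum_congr rfl fun p _ => by rw [H']
  rw [add_neg_cancel, Ring.choose_zero_pos ℤ (Nat.pos_of_ne_zero hd0), ← sub_eq_add_neg, hd,
    Ring.choose_natCast] at h1
  simp at h1

variable {K : Type*} [Field K] {n : ℕ}

/-- A family of subgroups of a `𝒟`-module which spans it, is compatible with the grading of `𝒟`, and
on which the Euler operators act by binomial coefficients of the degree. Its sum is then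
automatically direct. -/
structure EulerianGrading {X : Type*} [AddCommGroup X] [Module (DiffOp K n) X]
    (gr : ℤ → AddSubgroup X) : Prop where
  iSup_eq_top : ⨆ k, gr k = ⊤
  smul_mem : ∀ i j : ℤ, ∀ d ∈ diffOpsGrading K n i, ∀ z ∈ gr j, d • z ∈ gr (i + j)
  eulerOp_smul : ∀ r : ℕ, 1 ≤ r → ∀ k : ℤ, ∀ z ∈ gr k, eulerOp K n r • z = Ring.choose k r • z

namespace EulerianGrading

variable {X : Type*} [AddCommGroup X] [Module (DiffOp K n) X] {gr : ℤ → AddSubgroup X}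

theorem eulerOp_smul' (h : EulerianGrading (K := K) (n := n) gr) (r : ℕ) {k : ℤ} {z : X}
    (hz : z ∈ gr k) : eulerOp K n r • z = Ring.choose k r • z := by
  rcases Nat.eq_zero_or_pos r with rfl | hr
  · rw [eulerOp_zero, Ring.choose_zero_right, one_smul, one_smul]
  · exact h.eulerOp_smul r hr k z hz

/-- Operators projecting onto a component and killing finitely many others. -/
theorem exists_projection (h : EulerianGrading (K := K) (n := n) gr) (k : ℤ) (F : Finset ℤ)
    (hk : k ∉ F) : ∃ (P : DiffOp K n) (c : ℤ → K),
      (∀ l, ∀ z ∈ gr l, P • z = algebraMap K (DiffOp K n) (c l) • z) ∧ c k = 1 ∧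
        ∀ l ∈ F, c l = 0 := by
  induction F using Finset.induction_on with
  | empty => exact ⟨1, 1, fun l z _ => by simp, rfl, by simp⟩
  | insert m F hm ih =>
    rw [mem_insert, not_or] at hk
    obtain ⟨P, c, hP, hck, hcF⟩ := ih hk.2
    obtain ⟨r, -, hr'⟩ := exists_choose_ne K hk.1
    set q : ℤ → K := fun l => ((Ring.choose l r : ℤ) : K) with hq
    have hkm : q k - q m ≠ 0 := sub_ne_zero.mpr hr'
    -- Lagrange interpolation: the new factor acts as `1` in degree `k` and as `0` in degree `m`.
    refine ⟨P * (algebraMap K _ (q k - q m)⁻¹ * (eulerOp K n r - algebraMap K _ (q m))),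
      fun l => (q k - q m)⁻¹ * (q l - q m) * c l, fun l z hz => ?_, ?_, ?_⟩
    · have hE : eulerOp K n r • z = algebraMap K (DiffOp K n) (q l) • z := by
        rw [h.eulerOp_smul' r hz, ← Int.cast_smul_eq_zsmul (DiffOp K n)]
        exact congrArg (· • z) (map_intCast (algebraMap K (DiffOp K n)) _).symm
      rw [← smul_smul, ← smul_smul, sub_smul, hE, ← sub_smul, ← map_sub, smul_smul _ _ z,
        ← map_mul, smul_smul, ← Algebra.commutes, ← smul_smul, hP l z hz, smul_smul, ← map_mul]
    · simp only [hck, mul_one]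
      exact inv_mul_cancel₀ hkm
    · intro l hl
      rcases mem_insert.mp hl with rfl | hl
      · simp
      · simp [hcF l hl]

theorem smul_sum_eq (F : Finset ℤ) {z : ℤ → X} (hz : ∀ k, z k ∈ gr k) {k : ℤ} (hk : k ∈ F)
    {P : DiffOp K n} {c : ℤ → K}
    (hP : ∀ l, ∀ z ∈ gr l, P • z = algebraMap K (DiffOp K n) (c l) • z) (hck : c k = 1)
    (hcF : ∀ l ∈ F.erase k, c l = 0) : P • ∑ l ∈ F, z l = z k := by
  rw [smul_sum, ← add_sum_erase F _ hk, hP k _ (hz k), hck, map_one, one_smul,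
    sum_eq_zero fun l hl => ?_, add_zero]
  rw [hP l _ (hz l), hcF l hl, map_zero, zero_smul]

/-- Submodules of modules with an Eulerian grading are homogeneous. -/
theorem mem_of_sum_mem (h : EulerianGrading (K := K) (n := n) gr) (N : Submodule (DiffOp K n) X)
    (F : Finset ℤ) {z : ℤ → X} (hz : ∀ k, z k ∈ gr k) (hN : ∑ l ∈ F, z l ∈ N) {k : ℤ}
    (hk : k ∈ F) : z k ∈ N := by
  obtain ⟨P, c, hP, hck, hcF⟩ := h.exists_projection k (F.erase k) (notMem_erase k F)
  rw [← smul_sum_eq F hz hk hP hck hcF]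
  exact N.smul_mem P hN

theorem exists_sum_eq (h : EulerianGrading (K := K) (n := n) gr) (x : X) :
    ∃ (F : Finset ℤ) (z : ℤ → X), (∀ k, z k ∈ gr k) ∧ ∑ k ∈ F, z k = x := by
  have hx : x ∈ ⨆ k, gr k := h.iSup_eq_top ▸ AddSubgroup.mem_top x
  classical
  refine AddSubgroup.iSup_induction gr
    (C := fun x => ∃ (F : Finset ℤ) (z : ℤ → X), (∀ k, z k ∈ gr k) ∧ ∑ k ∈ F, z k = x) hx
    (fun k z hz => ?_) ?_ fun x y hx hy => ?_
  · refine ⟨{k}, Pi.single k z, fun l => ?_, by simp⟩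
    by_cases hl : l = k
    · subst hl; simpa using hz
    · simp [hl]
  · exact ⟨∅, 0, fun k => zero_mem _, by simp⟩
  · obtain ⟨F, z, hz, rfl⟩ := hx
    obtain ⟨G, w, hw, rfl⟩ := hy
    refine ⟨F ∪ G, fun k => (if k ∈ F then z k else 0) + if k ∈ G then w k else 0,
      fun k => add_mem ?_ ?_, ?_⟩
    · split_ifs
      exacts [hz k, zero_mem _]
    · split_ifs
      exacts [hw k, zero_mem _]
    · rw [sum_add_distrib, sum_ite_mem, sum_ite_mem, inter_eq_right.mpr subset_union_left,
        inter_eq_right.mpr subset_union_right]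

/-- Injectivity is homogeneity of the zero submodule: if a sum of homogeneous elements lies in `⊥`,
so does each summand. -/
theorem isInternal (h : EulerianGrading (K := K) (n := n) gr) : DirectSum.IsInternal gr := by
  classical
  constructor
  · rw [injective_iff_map_eq_zero]
    intro x hx
    have hsum : ∑ k ∈ DFinsupp.support x, (x k : X) = 0 := by
      rw [← hx, DirectSum.coeAddMonoidHom_eq_dfinsuppSum]
      rfl
    refine DFinsupp.ext fun k => Subtype.ext ?_
    by_cases hk : k ∈ DFinsupp.support x
    · exact (Submodule.mem_bot (DiffOp K n)).mp (h.mem_of_sum_mem ⊥ _ (fun k => (x k).2)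
        ((Submodule.mem_bot _).mpr hsum) hk)
    · simpa using hk
  · intro x
    obtain ⟨F, z, hz, rfl⟩ := h.exists_sum_eq x
    refine ⟨∑ k ∈ F, DirectSum.of (fun k => gr k) k ⟨z k, hz k⟩, ?_⟩
    rw [map_sum]
    exact sum_congr rfl fun k _ => DirectSum.coeAddMonoidHom_of gr k _

theorem pi {ι : Type*} [Finite ι] {Y : ι → Type*} [∀ i, AddCommGroup (Y i)]
    [∀ i, Module (DiffOp K n) (Y i)] {gr : ∀ i, ℤ → AddSubgroup (Y i)}
    (h : ∀ i, EulerianGrading (K := K) (n := n) (gr i)) :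
    EulerianGrading (K := K) (n := n)
      fun k => AddSubgroup.pi Set.univ fun i => gr i k where
  iSup_eq_top := by
    classical
    have := Fintype.ofFinite ι
    refine (AddSubgroup.eq_top_iff' _).mpr fun x => ?_
    rw [← univ_sum_single x]
    refine sum_mem fun i _ => ?_
    have hi : x i ∈ ⨆ k, gr i k := (h i).iSup_eq_top ▸ AddSubgroup.mem_top _
    refine AddSubgroup.iSup_induction (gr i) (C := fun z => Pi.single i z ∈ ⨆ k : ℤ,
      AddSubgroup.pi Set.univ fun i => gr i k) hi (fun k z hz => ?_) ?_ fun x y hx hy => ?_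
    · refine AddSubgroup.mem_iSup_of_mem k fun j _ => ?_
      by_cases hj : j = i
      · subst hj; simpa using hz
      · simp [hj]
    · rw [Pi.single_zero]; exact zero_mem _
    · rw [Pi.single_add]; exact add_mem hx hy
  smul_mem i j d hd z hz A _ := (h A).smul_mem i j d hd _ (hz A trivial)
  eulerOp_smul r hr k z hz := funext fun A => (h A).eulerOp_smul r hr k _ (hz A trivial)

/-- Only spanning needs an argument: the components of an element of `N` lie in `N` by
`mem_of_sum_mem`. -/
theorem submodule (h : EulerianGrading (K := K) (n := n) gr) (N : Submodule (DiffOp K n) X) :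
    EulerianGrading (K := K) (n := n) fun k => (gr k).comap N.subtype.toAddMonoidHom where
  iSup_eq_top := by
    refine (AddSubgroup.eq_top_iff' _).mpr fun x => ?_
    obtain ⟨F, z, hz, hx⟩ := h.exists_sum_eq (x : X)
    have hN : ∀ k ∈ F, z k ∈ N := fun k hk => h.mem_of_sum_mem N F hz (hx ▸ x.2) hk
    have : x = ∑ k ∈ F.attach, ⟨z k, hN k k.2⟩ := by
      refine Subtype.ext ?_
      rw [← hx, Submodule.coe_sum, ← sum_attach]
    rw [this]
    exact sum_mem fun k _ => AddSubgroup.mem_iSup_of_mem k.1 (hz k)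
  smul_mem i j d hd z hz := h.smul_mem i j d hd _ hz
  eulerOp_smul r hr k z hz := Subtype.ext (h.eulerOp_smul r hr k _ hz)

/-- The three conditions pass to images at once. Directness, the usual difficulty with quotients, is
not among them and follows from `isInternal`. -/
theorem quotient (h : EulerianGrading (K := K) (n := n) gr) (N : Submodule (DiffOp K n) X) :
    EulerianGrading (K := K) (n := n) fun k => (gr k).map N.mkQ.toAddMonoidHom where
  iSup_eq_top := by
    rw [← AddSubgroup.map_iSup, h.iSup_eq_top]
    exact AddSubgroup.map_top_of_surjective _ N.mkQ_surjective
  smul_mem := by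
    rintro i j d hd _ ⟨z, hz, rfl⟩
    exact ⟨d • z, h.smul_mem i j d hd z hz, map_smul N.mkQ d z⟩
  eulerOp_smul := by
    rintro r hr k _ ⟨z, hz, rfl⟩
    refine (map_smul N.mkQ (eulerOp K n r) z).symm.trans ?_
    rw [h.eulerOp_smul r hr k z hz]
    exact map_zsmul N.mkQ _ z

end EulerianGrading

theorem DModule.isEulerian_iff {K : Type u} [Field K] {M : DModule K n} :
    M.IsEulerian ↔ EulerianGrading (K := K) (n := n) M.gr :=
  ⟨fun h => ⟨by
    refine (AddSubgroup.eq_top_iff' _).mpr fun x => ?_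
    obtain ⟨y, rfl⟩ := h.1.1.2 x
    induction y using DirectSum.induction_on with
    | zero => rw [map_zero]; exact zero_mem _
    | of k z =>
      rw [DirectSum.coeAddMonoidHom_of]
      exact AddSubgroup.mem_iSup_of_mem k z.2
    | add x y hx hy => rw [map_add]; exact add_mem hx hy, h.1.2, h.2⟩,
  fun h => ⟨⟨h.isInternal, h.smul_mem⟩, h.eulerOp_smul⟩⟩

/-- The polynomial ring is Eulerian. -/
theorem eulerianGrading_polyModule (K : Type u) [Field K] (n : ℕ) :
    EulerianGrading (K := K) (n := n) (polyModule K n).gr where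
  iSup_eq_top := by
    refine (AddSubgroup.eq_top_iff' _).mpr fun g => ?_
    change MvPolynomial (Fin n) K at g
    rw [g.as_sum]
    exact sum_mem fun a _ => AddSubgroup.mem_iSup_of_mem (a.degree : ℤ)
      (monomial_mem_polyModule_gr fun _ => rfl)
  smul_mem := by
    refine smul_mem_of_generators (X := MvPolynomial (Fin n) K) ?_ ?_
    · intro e k (f : MvPolynomial (Fin n) K) hf z hz a ha
      change MvPolynomial.coeff a (f * z : MvPolynomial (Fin n) K) ≠ 0 at ha
      obtain ⟨⟨b, c⟩, hbc, h⟩ := exists_ne_zero_of_sum_ne_zero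
        (by rwa [MvPolynomial.coeff_mul] at ha)
      have hb := hf b (left_ne_zero_of_mul h)
      have hc := hz c (right_ne_zero_of_mul h)
      rw [← (HasAntidiagonal.mem_antidiagonal.mp hbc), map_add, Nat.cast_add, hb, hc]
    · intro i j k z hz
      refine polyModule_gr_induction
        (p := fun z => del K i j • z ∈ (polyModule K n).gr (-j + k)) ?_ ?_ ?_ hz
      · intro a c ha
        rw [del_smul_poly, hasse_monomial]
        refine monomial_mem_polyModule_gr fun h => ?_
        -- A nonzero coefficient excludes truncation, so the degree drops by exactly `j`.
        have hij : Finsupp.single i j ≤ a := by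
          rw [Finsupp.single_le_iff]
          by_contra! hlt
          simp [Nat.choose_eq_zero_of_lt hlt] at h
        have := congrArg Finsupp.degree (tsub_add_cancel_of_le hij)
        rw [map_add, Finsupp.degree_single] at this
        omega
      · rw [smul_zero]; exact zero_mem _
      · intro f g hf hg
        rw [smul_add]; exact add_mem hf hg
  eulerOp_smul r _ k z hz := by
    refine polyModule_gr_induction
      (p := fun z => eulerOp K n r • z = Ring.choose k r • z) ?_ ?_ ?_ hz
    · intro a c ha
      rw [eulerOp_smul_monomial, ← ha, Ring.choose_natCast, natCast_zsmul]
    · rw [smul_zero, smul_zero]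
    · intro f g hf hg
      rw [smul_add, smul_add, hf, hg]

end Grading

/-! ### Cancelling denominators in `S⁻¹M` -/

section Localization

variable {K : Type u} [Field K] {n : ℕ} {X : Type u} [AddCommGroup X] [Module (DiffOp K n) X]
  {S : Submonoid (MvPolynomial (Fin n) K)}

theorem ofPoly_smul_oreDiv {s : MvPolynomial (Fin n) K} (hs : s ∈ S) (z : X) :
    ofPoly K n s • OreLocalization.oreDiv z (⟨ofPoly K n s, Submonoid.mem_map_of_mem _ hs⟩ : mulSet S) =
      OreLocalization.oreDiv z 1 := by
  rw [← OreLocalization.oreDiv_one_smul]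
  exact OreLocalization.smul_cancel (s := ⟨ofPoly K n s, Submonoid.mem_map_of_mem _ hs⟩)

theorem one_oreDiv_smul_ofPoly_smul {s : MvPolynomial (Fin n) K} (hs : s ∈ S)
    (w : OreLocalization (mulSet S) X) :
    OreLocalization.oreDiv (1 : DiffOp K n)
      (⟨ofPoly K n s, Submonoid.mem_map_of_mem _ hs⟩ : mulSet S) • ofPoly K n s • w = w := by
  rw [← OreLocalization.oreDiv_one_smul, smul_smul, OreLocalization.mul_div_one, one_mul,
    OreLocalization.div_eq_one', one_smul]

theorem ofPoly_smul_injective {s : MvPolynomial (Fin n) K} (hs : s ∈ S) :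
    Function.Injective fun w : OreLocalization (mulSet S) X => ofPoly K n s • w :=
  Function.LeftInverse.injective (one_oreDiv_smul_ofPoly_smul hs)

theorem ofPoly_comm_smul (f g : MvPolynomial (Fin n) K) (w : X) :
    ofPoly K n f • ofPoly K n g • w = ofPoly K n g • ofPoly K n f • w := by
  rw [smul_smul, smul_smul, ← map_mul, ← map_mul, mul_comm]

end Localization

/-! ### The grading of a localization -/

section LocGr

variable {K : Type u} [Field K] {n : ℕ} {M : DModule K n} {S : Submonoid (MvPolynomial (Fin n) K)}

theorem oreDiv_mem_locGr {s : MvPolynomial (Fin n) K} (hs : s ∈ S) {e : ℕ} (he : s.IsHomogeneous e)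
    {k l : ℤ} {z : M.carrier} (hz : z ∈ M.gr l) (hl : l = k + e) :
    OreLocalization.oreDiv z (⟨ofPoly K n s, Submonoid.mem_map_of_mem _ hs⟩ : mulSet S) ∈
      locGr M S k :=
  AddSubgroup.subset_closure ⟨s, hs, e, z, he, hl ▸ hz, rfl⟩

theorem oreDiv_one_mem_locGr {k : ℤ} {z : M.carrier} (hz : z ∈ M.gr k) :
    OreLocalization.oreDiv z (1 : mulSet S) ∈ locGr M S k := by
  have := oreDiv_mem_locGr (one_mem S) (MvPolynomial.isHomogeneous_one (Fin n) K) hz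
    (k := k) (by simp)
  convert this
  simp

theorem locGr_induction {k : ℤ} {p : OreLocalization (mulSet S) M.carrier → Prop}
    (oreDiv : ∀ (s : MvPolynomial (Fin n) K) (hs : s ∈ S) (e : ℕ) (z : M.carrier),
      s.IsHomogeneous e → z ∈ M.gr (k + e) →
        p (OreLocalization.oreDiv z ⟨ofPoly K n s, Submonoid.mem_map_of_mem _ hs⟩))
    (zero : p 0) (add : ∀ x y, p x → p y → p (x + y)) (neg : ∀ x, p x → p (-x))
    {w : OreLocalization (mulSet S) M.carrier} (hw : w ∈ locGr M S k) : p w := by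
  induction hw using AddSubgroup.closure_induction with
  | mem w hw =>
    obtain ⟨s, hs, e, z, he, hz, rfl⟩ := hw
    exact oreDiv s hs e z he hz
  | zero => exact zero
  | add x y _ _ hx hy => exact add x y hx hy
  | neg x _ hx => exact neg x hx

/-- Dividing by `s` sends `z / t` to `z / (t s)`, lowering degrees by `e`. Degrees can thus be
checked after clearing a denominator. -/
theorem mem_locGr_of_ofPoly_smul_mem {s : MvPolynomial (Fin n) K} (hs : s ∈ S) {e : ℕ}
    (he : s.IsHomogeneous e) {k : ℤ} {w : OreLocalization (mulSet S) M.carrier}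
    (hw : ofPoly K n s • w ∈ locGr M S (k + e)) : w ∈ locGr M S k := by
  rw [← one_oreDiv_smul_ofPoly_smul hs w]
  refine locGr_induction (p := fun v => OreLocalization.oreDiv (1 : DiffOp K n)
      (⟨ofPoly K n s, Submonoid.mem_map_of_mem _ hs⟩ : mulSet S) • v ∈ locGr M S k)
    ?_ ?_ ?_ ?_ hw
  · intro t ht d z hd hz
    rw [OreLocalization.one_div_smul]
    have := oreDiv_mem_locGr (M := M) (mul_mem ht hs) (hd.mul he) (k := k) hz (by push_cast; ring)
    convert this
    rw [map_mul]
    rfl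
  · rw [smul_zero]; exact zero_mem _
  · intro x y hx hy
    rw [smul_add]; exact add_mem hx hy
  · intro x hx
    rw [smul_neg]; exact neg_mem hx

/-- Localizing at homogeneous elements preserves Eulerian gradings. -/
theorem EulerianGrading.locGr (h : EulerianGrading (K := K) (n := n) M.gr)
    (hS : ∀ s ∈ S, ∃ e : ℕ, s.IsHomogeneous e) :
    EulerianGrading (K := K) (n := n) (locGr M S) where
  iSup_eq_top := by
    refine (AddSubgroup.eq_top_iff' _).mpr fun w => ?_
    induction w using OreLocalization.ind with | _ z s =>
    obtain ⟨_, s, hs, rfl⟩ := s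
    obtain ⟨e, he⟩ := hS s hs
    have hz : z ∈ ⨆ k, M.gr k := h.iSup_eq_top ▸ AddSubgroup.mem_top z
    refine AddSubgroup.iSup_induction M.gr (C := fun z => OreLocalization.oreDiv z
      (⟨ofPoly K n s, Submonoid.mem_map_of_mem _ hs⟩ : mulSet S) ∈ ⨆ k, Eulerian.locGr M S k) hz
      (fun k z hz => ?_) ?_ fun x y hx hy => ?_
    · exact AddSubgroup.mem_iSup_of_mem (k - e) (oreDiv_mem_locGr hs he hz (by ring))
    · rw [OreLocalization.zero_oreDiv]; exact zero_mem _
    · rw [← OreLocalization.add_oreDiv]; exact add_mem hx hy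
  smul_mem := by
    have hpoly : ∀ (d k : ℤ), ∀ f ∈ (polyModule K n).gr d, ∀ w ∈ Eulerian.locGr M S k,
        ofPoly K n f • w ∈ Eulerian.locGr M S (d + k) := by
      intro d k (f : MvPolynomial (Fin n) K) hf w hw
      refine locGr_induction (p := fun w => ofPoly K n f • w ∈ Eulerian.locGr M S (d + k))
        ?_ ?_ ?_ ?_ hw
      · intro s hs e z he hz
        refine mem_locGr_of_ofPoly_smul_mem hs he ?_
        rw [ofPoly_comm_smul, ofPoly_smul_oreDiv hs,
          OreLocalization.smul_oreDiv_one, add_assoc]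
        exact oreDiv_one_mem_locGr (h.smul_mem _ _ _ (ofPoly_mem_diffOpsGrading hf) _ hz)
      · rw [smul_zero]; exact zero_mem _
      · intro x y hx hy
        rw [smul_add]; exact add_mem hx hy
      · intro x hx
        rw [smul_neg]; exact neg_mem hx
    refine smul_mem_of_generators hpoly fun i j => ?_
    induction j using Nat.strong_induction_on with | _ j ih =>
    intro k w hw
    refine locGr_induction (p := fun w => del K i j • w ∈ Eulerian.locGr M S (-j + k))
      ?_ ?_ ?_ ?_ hw
    · intro s hs e z he hz
      refine mem_locGr_of_ofPoly_smul_mem hs he ?_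
      set w := OreLocalization.oreDiv z
        (⟨ofPoly K n s, Submonoid.mem_map_of_mem _ hs⟩ : mulSet S)
      have hw : w ∈ Eulerian.locGr M S k := oreDiv_mem_locGr hs he hz rfl
      have h1 : del K i j • ofPoly K n s • w ∈ Eulerian.locGr M S (-j + k + e) := by
        rw [ofPoly_smul_oreDiv hs, OreLocalization.smul_oreDiv_one, add_assoc]
        exact oreDiv_one_mem_locGr (h.smul_mem _ _ _ (del_mem_diffOpsGrading i j) _ hz)
      have h0 : ((0, j) : ℕ × ℕ) ∈ antidiagonal j := by simp
      -- In the Leibniz expansion of `∂_i^{[j]} (s w)` the term `(0, j)` is `s ∂_i^{[j]} w`. The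
      -- others involve `∂_i^{[p.2]} w` with `p.2 < j` and fall under the induction hypothesis.
      rw [smul_smul, del_mul_ofPoly, sum_smul, ← add_sum_erase _ _ h0, hasse_zero,
        Module.End.one_apply, ← smul_smul] at h1
      refine (AddSubgroup.add_mem_cancel_right _ (sum_mem fun p hp => ?_)).mp h1
      obtain ⟨hp0, hp⟩ := mem_erase.mp hp
      rw [HasAntidiagonal.mem_antidiagonal] at hp
      have hlt : p.2 < j := by
        rcases Nat.eq_zero_or_pos p.1 with h | h
        · exact absurd (Prod.ext h (by simpa [h] using hp)) hp0
        · omega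
      have hs' : hasse i p.1 s ∈ (polyModule K n).gr (-p.1 + e) :=
        (eulerianGrading_polyModule K n).smul_mem _ _ _ (del_mem_diffOpsGrading i p.1) s
          (IsHomogeneous.mem_polyModule_gr he)
      rw [← smul_smul]
      have := hpoly _ _ _ hs' _ (ih p.2 hlt k w hw)
      convert this using 1
      congr 1
      rw [← hp]
      push_cast
      ring
    · rw [smul_zero]; exact zero_mem _
    · intro x y hx hy
      rw [smul_add]; exact add_mem hx hy
    · intro x hx
      rw [smul_neg]; exact neg_mem hx
  eulerOp_smul r hr k w hw := by
    -- The induction on `r` descends to `r = 0`.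
    clear hr
    -- Eigenvalues are viewed in `𝒟`, so that they can be multiplied with operators and commuted
    -- past `s`.
    rw [← Int.cast_smul_eq_zsmul (DiffOp K n)]
    refine locGr_induction
      (p := fun w => eulerOp K n r • w = ((Ring.choose k r : ℤ) : DiffOp K n) • w)
      ?_ ?_ ?_ ?_ hw
    · intro s hs e z he hz
      set w := OreLocalization.oreDiv z
        (⟨ofPoly K n s, Submonoid.mem_map_of_mem _ hs⟩ : mulSet S)
      induction r using Nat.strong_induction_on with | _ r ih =>
      have h1 : eulerOp K n r • ofPoly K n s • w =
          ((Ring.choose (k + e) r : ℤ) : DiffOp K n) • ofPoly K n s • w := by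
        rw [ofPoly_smul_oreDiv hs, OreLocalization.smul_oreDiv_one,
          OreLocalization.smul_oreDiv_one, h.eulerOp_smul' r hz, Int.cast_smul_eq_zsmul]
      rw [smul_smul, eulerOp_mul_ofPoly r e he, ← smul_smul, smul_smul _ (ofPoly K n s),
        (Int.cast_commute _ _).eq, ← smul_smul] at h1
      -- With `s` cancelled, `∑ binom(e, p.1) E_{p.2} w = binom(k + e, r) w`. Expanding the right
      -- side by Vandermonde, the terms with `p.2 < r` match by induction, leaving `E_r w = binom(k,
      -- r) w`.
      have h2 := ofPoly_smul_injective hs h1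
      have h0 : ((0, r) : ℕ × ℕ) ∈ antidiagonal r := by simp
      have hc : ((Ring.choose (k + e) r : ℤ) : DiffOp K n) = ∑ p ∈ antidiagonal r,
          ((Ring.choose (e : ℤ) p.1 * Ring.choose k p.2 : ℤ) : DiffOp K n) := by
        rw [add_comm k, choose_add]
        exact Int.cast_sum _ _
      rw [hc, sum_smul, sum_smul, ← add_sum_erase _ _ h0,
        ← add_sum_erase _ _ h0, sum_congr rfl fun p hp => ?_] at h2
      · simpa using add_right_cancel h2
      · obtain ⟨hp0, hp⟩ := mem_erase.mp hp
        rw [HasAntidiagonal.mem_antidiagonal] at hp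
        have hlt : p.2 < r := by
          rcases Nat.eq_zero_or_pos p.1 with h | h
          · exact absurd (Prod.ext h (by simpa [h] using hp)) hp0
          · omega
        rw [nsmul_eq_mul, ← smul_smul, ih p.2 hlt, Ring.choose_natCast, smul_smul, Int.cast_mul,
          Int.cast_natCast]
    · rw [smul_zero, smul_zero]
    · intro x y hx hy
      rw [smul_add, smul_add, hx, hy]
    · intro x hx
      rw [smul_neg, smul_neg, hx]

end LocGr

/-! ### Čech cohomology and iteration -/

theorem exists_isHomogeneous_of_mem_mulGen {K : Type u} [Field K] {n l : ℕ}
    {f : Fin l → MvPolynomial (Fin n) K} (hf : ∀ j, ∃ e : ℕ, (f j).IsHomogeneous e)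
    (A : Finset (Fin l)) {s : MvPolynomial (Fin n) K} (hs : s ∈ mulGen f A) :
    ∃ e : ℕ, s.IsHomogeneous e := by
  induction hs using Submonoid.closure_induction with
  | mem s hs =>
    obtain ⟨j, -, rfl⟩ := hs
    exact hf j
  | one => exact ⟨0, MvPolynomial.isHomogeneous_one _ _⟩
  | mul s t _ _ hs ht =>
    obtain ⟨d, hd⟩ := hs
    obtain ⟨e, he⟩ := ht
    exact ⟨d + e, hd.mul he⟩

/-- Local cohomology of an Eulerian graded `𝒟`-module is Eulerian. -/
theorem DModule.IsEulerian.localCohomology {K : Type u} [Field K] {n : ℕ}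
    {J : Ideal (MvPolynomial (Fin n) K)} (g : HomogeneousGenerators J) (i : ℕ) {M : DModule K n}
    (h : M.IsEulerian) : (localCohomology g i M).IsEulerian :=
  DModule.isEulerian_iff.mpr <|
    -- Cohomology is a quotient of a submodule of a finite product of localizations; each of these
    -- operations preserves Eulerian gradings.
    ((EulerianGrading.pi fun A => (DModule.isEulerian_iff.mp h).locGr fun _ hs =>
      exists_isHomogeneous_of_mem_mulGen g.isHomogeneous A.1 hs).submodule _).quotient _

end Eulerian

theorem mainTheorem2 {K : Type*} [Field K] {n s : ℕ}
    (J : Fin s → Ideal (MvPolynomial (Fin n) K))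
    (hJ : ∀ k, (J k).IsHomogeneous (MvPolynomial.homogeneousSubmodule (Fin n) K))
    (g : (k : Fin s) → Eulerian.HomogeneousGenerators (J k)) (i : Fin s → ℕ) :
    (Eulerian.iteratedLocalCohomology g i).IsEulerian := by
  induction s with
  | zero => exact Eulerian.DModule.isEulerian_iff.mpr (Eulerian.eulerianGrading_polyModule K n)
  | succ s ih => exact (ih _ (fun k => hJ k.succ) _ _).localCohomology (g 0) (i 0)
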